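/- Let $q\ge 4$ be a prime power, let $n=q^2-1$, and let $\mathbb F_q$ be the field with $q$ elements. Definitions. For $G(D)=(g_{ij})\in\mathbb F_q[D]^{k\times n}$ put $\gamma_i=\max_j\deg g_{ij}$ (with $\deg 0=0$). The matrix $G(D)$ is basic if it has a polynomial right inverse. A basic matrix is reduced if $\sum_i\gamma_i$ is smallest among all basic generator matrices of the same code $\{u(D)G(D):u(D)\in\mathbb F_q[D]^k\}$. A convolutional code with parameters $(n,k,\gamma;\mu,d_{free})_q$ is a submodule $C=\{u(D)G(D):u(D)\in\mathbb F_q[D]^k\}$ of $\mathbb F_q[D]^n$, where $G(D)\in\mathbb F_q[D]^{k\times n}$ is reduced and basic, $\gamma=\sum_i\gamma_i$, $\mu=\max_i\gamma_i$, and $d_{free}$ is the minimum weight (number of nonzero coefficients, over all coordinates) of a nonzero element of $C$. For $u(D)=\sum_i u_iD^i$ and $v(D)=\sum_i v_iD^i$ in $\mathbb F_q[D]^n$ let $\langle u(D)\mid v(D)\rangle=\sum_i u_i\cdot v_i$. The Euclidean dual $V^\perp$ of a submodule $V\subseteq\mathbb F_q[D]^n$ is the submodule of all $u(D)$ with $\langle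 D^iu(D)\mid v(D)\rangle=0$ for all $i\ge 0$ and all $v(D)\in V$. Theorem. There is a convolutional code with parameters $(n,\,n-2q+1,\,2q-3;\,1,\,d_{free}\ge 2q+1)_q$. Moreover, such a code is obtained as follows. Let $\alpha$ be any primitive element of $\mathbb F_{q^2}$ and $\mathcal B$ any $\mathbb F_q$-basis of $\mathbb F_{q^2}$. Let $H_{C_0}$ be obtained from the matrix with rows $(1,\alpha^{s},\alpha^{2s},\dots,\alpha^{(n-1)s})$, $s=0,1,\dots,q-1$, by expanding each entry as the column of its two coordinates with respect to $\mathcal B$ and removing linearly dependent rows (so that the remaining rows form a basis of the row space). Let $H_{C_1}$ be obtained in the same way from $s=q+1,q+2,\dots,2q-1$. Then $H_{C_0}$ has $2q-1$ rows and $H_{C_1}$ has $2q-3$ rows. Let $\tilde H_{C_1}$ be $H_{C_1}$ with two zero rows added at the bottom, and let $V$ be the code generated by $G(D)=H_{C_0}+\tilde H_{C_1}D$. Then $V^\perp$ is a convolutional code with parameters $(n,\,n-2q+1,\,2q-3;\,1,\,d_{free}\ge 2q+1)_q$. -/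

import Mathlib

open Polynomial

noncomputable section

namespace ConvCode

variable {F : Type*} [Field F] {k n : ℕ}

/-- The submodule `{u(D) G(D) : u(D) ∈ F[D]^k}` of `F[D]^n` generated by the rows of `G(D)`. -/
def generatedCode (G : Matrix (Fin k) (Fin n) F[X]) : Submodule F[X] (Fin n → F[X]) :=
  LinearMap.range G.vecMulLinear

/-- The constraint length `γ_i = max_j deg g_{ij}` of the `i`-th row. -/
def rowDegree (G : Matrix (Fin k) (Fin n) F[X]) (i : Fin k) : ℕ :=
  Finset.univ.sup fun j => (G i j).natDegree

/-- The overall constraint length `γ = ∑_i γ_i`. -/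
def constraintLength (G : Matrix (Fin k) (Fin n) F[X]) : ℕ :=
  ∑ i, rowDegree G i

/-- The memory `μ = max_i γ_i`. -/
def memory (G : Matrix (Fin k) (Fin n) F[X]) : ℕ :=
  Finset.univ.sup fun i => rowDegree G i

/-- `G(D)` is basic: it has a polynomial right inverse. -/
def IsBasic (G : Matrix (Fin k) (Fin n) F[X]) : Prop :=
  ∃ R : Matrix (Fin n) (Fin k) F[X], G * R = 1

/-- `G(D)` is basic, and its overall constraint length is the smallest one among all basic
generator matrices of the same code. -/
def IsReducedBasic (G : Matrix (Fin k) (Fin n) F[X]) : Prop :=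
  IsBasic G ∧ ∀ G' : Matrix (Fin k) (Fin n) F[X], IsBasic G' →
    generatedCode G' = generatedCode G → constraintLength G ≤ constraintLength G'

/-- The weight of a word `v(D)`: the number of nonzero coefficients of all its components. -/
def weight (v : Fin n → F[X]) : ℕ :=
  ∑ j, (v j).support.card

/-- The free distance: the minimum weight of a nonzero codeword. -/
def freeDistance (C : Submodule F[X] (Fin n → F[X])) : ℕ :=
  sInf {w | ∃ v ∈ C, v ≠ 0 ∧ weight v = w}

/-- `C` is a convolutional code with parameters `(n, k, γ; μ, d)`. -/
def HasParameters (C : Submodule F[X] (Fin n → F[X])) (k γ μ d : ℕ) : Prop :=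
  (∃ G : Matrix (Fin k) (Fin n) F[X], IsReducedBasic G ∧ generatedCode G = C ∧
    constraintLength G = γ ∧ memory G = μ) ∧ freeDistance C = d

/-- The Euclidean inner product `⟨u(D) | v(D)⟩ = ∑_i u_i · v_i` of the coefficient sequences. -/
def innerProd (u v : Fin n → F[X]) : F :=
  ∑ j, (u j).sum fun i a => a * (v j).coeff i

theorem innerProd_zero (v : Fin n → F[X]) : innerProd 0 v = 0 := by
  simp [innerProd]

theorem innerProd_add (u u' v : Fin n → F[X]) :
    innerProd (u + u') v = innerProd u v + innerProd u' v := by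
  simp only [innerProd, Pi.add_apply, ← Finset.sum_add_distrib]
  refine Finset.sum_congr rfl fun j _ => ?_
  exact Polynomial.sum_add_index _ _ _ (by simp) (by intros; ring)

theorem innerProd_C_smul (c : F) (u v : Fin n → F[X]) :
    innerProd ((C c : F[X]) • u) v = c * innerProd u v := by
  simp only [innerProd, Finset.mul_sum, Pi.smul_apply, smul_eq_mul]
  refine Finset.sum_congr rfl fun j _ => ?_
  rw [← Polynomial.smul_eq_C_mul, Polynomial.sum_smul_index _ _ _ (by simp)]
  simp only [Polynomial.sum, Finset.mul_sum, mul_assoc]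

/-- The Euclidean dual code: the words `u(D)` all of whose shifts `D^i u(D)` are orthogonal to
all codewords (equivalently, `u(D)` is orthogonal to all forward and backward shifts of the
codewords, as bi-infinite sequences). Ranging over all shifts makes the dual a submodule. -/
def dualCode (C : Submodule F[X] (Fin n → F[X])) : Submodule F[X] (Fin n → F[X]) where
  carrier := {u | ∀ i : ℕ, ∀ v ∈ C, innerProd ((X ^ i : F[X]) • u) v = 0}
  zero_mem' := fun i v _ => by rw [smul_zero, innerProd_zero]
  add_mem' := fun hu hu' i v hv => by
    rw [smul_add, innerProd_add, hu i v hv, hu' i v hv, add_zero]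
  smul_mem' := fun p u hu i v hv => by
    induction p using Polynomial.induction_on' with
    | add p r hp hr => rw [add_smul, smul_add, innerProd_add, hp, hr, add_zero]
    | monomial m c =>
      have h : (X ^ i : F[X]) • (monomial m c : F[X]) • u
          = (Polynomial.C c : F[X]) • (X ^ (i + m) : F[X]) • u := by
        rw [smul_smul, smul_smul, ← Polynomial.C_mul_X_pow_eq_monomial]
        congr 1
        ring
      rw [h, innerProd_C_smul, hu _ v hv, mul_zero]

/-- The matrix over `F` with `r * m` rows got from the matrix over `K` with rows
`(1, α^s, α^{2s}, …, α^{(n-1)s})`, `s = b, b + 1, …, b + r - 1`, by replacing each entry by the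
column of its coordinates with respect to the basis `B` of `K` over `F`. -/
def bchMatrix {K : Type*} [Field K] [Algebra F K] {m : ℕ} (B : Module.Basis (Fin m) F K) (α : K)
    (b r n : ℕ) : Matrix (Fin r × Fin m) (Fin n) F :=
  Matrix.of fun i j => B.repr (α ^ ((b + i.1) * j)) i.2

/-- `H` arises from `A` by removing linearly dependent rows: its rows are rows of `A`, they are
linearly independent, and they span the row space of `A`. -/
def IsRowSelection {ι : Type*} (A : Matrix ι (Fin n) F) (H : Matrix (Fin k) (Fin n) F) : Prop :=
  (∃ e : Fin k → ι, H = A.submatrix e id) ∧ LinearIndependent F H.row ∧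
    Submodule.span F (Set.range H.row) = Submodule.span F (Set.range A.row)

/-- `H` with zero rows added at the bottom, so that there are `k` rows in total. -/
def padRows {l : ℕ} (k : ℕ) (H : Matrix (Fin l) (Fin n) F) : Matrix (Fin k) (Fin n) F :=
  Matrix.of fun i j => if h : (i : ℕ) < l then H ⟨i, h⟩ j else 0

/-- The polynomial matrix `G(D) = H₀ + H̃₁ D`. -/
def unitMemoryMatrix {l : ℕ} (H₀ : Matrix (Fin k) (Fin n) F) (H₁ : Matrix (Fin l) (Fin n) F) :
    Matrix (Fin k) (Fin n) F[X] :=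
  Matrix.of fun i j => Polynomial.C (H₀ i j) + Polynomial.C (padRows k H₁ i j) * X

end ConvCode

end

/-! Write a word as `u = ∑ u_m D^m`. Pairing it and its shifts with the rows of `G(D) = H₀ + H̃₁ D`
shows that `V^⊥` is the kernel of `P = H₀ D + H̃₁` (`mem_dualCode_iff`). Distance: the lowest
nonzero coefficient of a word of `V^⊥` lies in `ker H₁` and the highest in `ker H₀`. The BCH bound
gives weights at least `q` and `q + 1`. If the two coefficients coincide, that vector has zeros at
the exponents `0, …, q - 1` and `q + 1, …, 2q - 1`, and at `q` by Frobenius from `1`. These are `2q`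
consecutive zeros, so the weight is again at least `2q + 1`. Ranks: the exponents `0` and `q + 1`
give powers in `F`, so each costs one row instead of two, and `k ≤ 2q - 1`, `l ≤ 2q - 3`. Over `K`
the joint row space contains the power vectors for `4q - 4` distinct exponents, independent by
Vandermonde. Hence both bounds are equalities and all rows are jointly independent. Parameters:
extend these rows to a basis of `F^n`. In the resulting coordinates `P u = 0` becomes `D x_r + y_r =
0` for `r < l` and `x_r = 0` otherwise, so a basis of the kernel is explicit. A maximal minor of
degree `l` shows that it is reduced. -/

namespace ConvCode

/-! ### The dual code as the kernel of a polynomial parity check matrix -/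

section Duality

variable {F : Type*} [Field F] {k l n : ℕ}

theorem innerProd_add_right (u v v' : Fin n → F[X]) :
    innerProd u (v + v') = innerProd u v + innerProd u v' := by
  simp only [innerProd, Pi.add_apply, ← Finset.sum_add_distrib, Polynomial.sum, coeff_add, mul_add]

theorem innerProd_zero_right (u : Fin n → F[X]) : innerProd u 0 = 0 := by
  simp [innerProd, Polynomial.sum]

theorem innerProd_sum_right {ι : Type*} (s : Finset ι) (u : Fin n → F[X]) (v : ι → Fin n → F[X]) :
    innerProd u (∑ i ∈ s, v i) = ∑ i ∈ s, innerProd u (v i) := by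
  classical
  induction s using Finset.induction_on with
  | empty => simp [innerProd_zero_right]
  | insert a s ha ih => rw [Finset.sum_insert ha, Finset.sum_insert ha, innerProd_add_right, ih]

/-- The polynomial parity check matrix `H₀ D + H̃₁` of the dual of the code generated by
`H₀ + H̃₁ D`. -/
noncomputable def parityMatrix (H₀ : Matrix (Fin k) (Fin n) F) (H₁ : Matrix (Fin l) (Fin n) F) :
    Matrix (Fin k) (Fin n) F[X] :=
  Matrix.of fun i j => C (H₀ i j) * X + C (padRows k H₁ i j)

theorem coeff_parityMatrix_mulVec_succ (H₀ : Matrix (Fin k) (Fin n) F)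
    (H₁ : Matrix (Fin l) (Fin n) F) (u : Fin n → F[X]) (r : Fin k) (m : ℕ) :
    ((parityMatrix H₀ H₁).mulVec u r).coeff (m + 1) =
      H₀.mulVec (fun j => (u j).coeff m) r +
        (padRows k H₁).mulVec (fun j => (u j).coeff (m + 1)) r := by
  simp [Matrix.mulVec, dotProduct, parityMatrix, add_mul, mul_assoc, Finset.sum_add_distrib,
    finsetSum_coeff]

theorem coeff_parityMatrix_mulVec_zero (H₀ : Matrix (Fin k) (Fin n) F)
    (H₁ : Matrix (Fin l) (Fin n) F) (u : Fin n → F[X]) (r : Fin k) :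
    ((parityMatrix H₀ H₁).mulVec u r).coeff 0 =
      (padRows k H₁).mulVec (fun j => (u j).coeff 0) r := by
  simp [Matrix.mulVec, dotProduct, parityMatrix, add_mul, mul_assoc, finsetSum_coeff]

/-- `D^m` times a row has only the coefficients `m` and `m + 1`, so it tests exactly one coefficient
of the syndrome. -/
theorem innerProd_monomial_smul_row (H₀ : Matrix (Fin k) (Fin n) F)
    (H₁ : Matrix (Fin l) (Fin n) F) (u : Fin n → F[X]) (r : Fin k) (m : ℕ) (c : F) :
    innerProd u ((monomial m c : F[X]) • unitMemoryMatrix H₀ H₁ r) =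
      c * ((parityMatrix H₀ H₁).mulVec u r).coeff (m + 1) := by
  rw [coeff_parityMatrix_mulVec_succ]
  simp only [Matrix.mulVec, dotProduct, ← Finset.sum_add_distrib, Finset.mul_sum, innerProd]
  refine Finset.sum_congr rfl fun j _ => ?_
  have h : ∀ i, ((monomial m c : F[X]) * unitMemoryMatrix H₀ H₁ r j).coeff i =
      (if i = m then c * H₀ r j else 0) + if i = m + 1 then c * padRows k H₁ r j else 0 := by
    intro i
    have : (monomial m c : F[X]) * unitMemoryMatrix H₀ H₁ r j =
        monomial m (c * H₀ r j) + monomial (m + 1) (c * padRows k H₁ r j) := by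
      simp only [unitMemoryMatrix, Matrix.of_apply, mul_add, ← C_mul_X_pow_eq_monomial, C_mul]
      ring
    rw [this, coeff_add, coeff_monomial, coeff_monomial]
    simp only [eq_comm]
  simp only [Pi.smul_apply, smul_eq_mul, h, Polynomial.sum, mul_add, Finset.sum_add_distrib, mul_ite,
    mul_zero, Finset.sum_ite_eq', mem_support_iff]
  congr 1
  · split_ifs with h0
    · ring
    · simp [notMem_support_iff.1 h0]
  · split_ifs with h0
    · ring
    · simp [notMem_support_iff.1 h0]

theorem mem_dualCode_iff (H₀ : Matrix (Fin k) (Fin n) F) (H₁ : Matrix (Fin l) (Fin n) F)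
    (u : Fin n → F[X]) :
    u ∈ dualCode (generatedCode (unitMemoryMatrix H₀ H₁)) ↔ (parityMatrix H₀ H₁).mulVec u = 0 := by
  constructor
  · intro hu
    ext r m
    have hrow : (monomial m 1 : F[X]) • unitMemoryMatrix H₀ H₁ r ∈
        generatedCode (unitMemoryMatrix H₀ H₁) :=
      Submodule.smul_mem _ _ ⟨Pi.single r 1, by simp [Matrix.row]⟩
    -- Pairings only reach syndrome coefficients of positive index; shifting `u` by `D` once makes
    -- the constant one visible too.
    have h := hu 1 _ hrow
    rwa [innerProd_monomial_smul_row, one_mul, Matrix.mulVec_smul, Pi.smul_apply, smul_eq_mul,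
      pow_one, coeff_X_mul] at h
  · rintro hu i _ ⟨w, rfl⟩
    have h : ∀ p : F[X], ∀ r, innerProd ((X ^ i : F[X]) • u) (p • unitMemoryMatrix H₀ H₁ r) = 0 := by
      intro p r
      induction p using Polynomial.induction_on' with
      | add p p' hp hp' => rw [add_smul, innerProd_add_right, hp, hp', add_zero]
      | monomial m c => rw [innerProd_monomial_smul_row, Matrix.mulVec_smul, hu]; simp
    have hw : Matrix.vecMulLinear (unitMemoryMatrix H₀ H₁) w =
        ∑ r, w r • unitMemoryMatrix H₀ H₁ r := by
      rw [Matrix.vecMulLinear_apply, Matrix.vecMul_eq_sum]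
    rw [hw, innerProd_sum_right]
    exact Finset.sum_eq_zero fun r _ => h _ _

theorem padRows_mulVec_eq_zero_iff (hl : l ≤ k) (H : Matrix (Fin l) (Fin n) F) (x : Fin n → F) :
    (∀ r, (padRows k H).mulVec x r = 0) ↔ H.mulVec x = 0 := by
  constructor
  · intro h
    ext r
    simpa [Matrix.mulVec, padRows, dotProduct] using h (r.castLE hl)
  · intro h r
    by_cases hr : (r : ℕ) < l
    · simpa [Matrix.mulVec, padRows, dotProduct, hr] using congrFun h ⟨r, hr⟩
    · simp [Matrix.mulVec, padRows, dotProduct, hr]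

end Duality

/-! ### Weight bounds -/

section Distance

variable {F : Type*} [Field F] {k l n : ℕ}

open Classical in
theorem sum_hammingNorm_coeff_le_weight (u : Fin n → F[X]) (s : Finset ℕ) :
    ∑ m ∈ s, hammingNorm (fun j => (u j).coeff m) ≤ weight u := by
  simp only [hammingNorm, Finset.card_filter, weight]
  rw [Finset.sum_comm]
  refine Finset.sum_le_sum fun j _ => ?_
  rw [← Finset.card_filter]
  exact Finset.card_le_card fun m hm => mem_support_iff.2 (Finset.mem_filter.1 hm).2

open Classical in
/-- A lower bound for the weights in the dual of a unit memory code, from the distances of the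
block codes with parity check matrices `H₀`, `H₁`, and both together. -/
theorem le_weight_of_mem_dualCode (hl : l ≤ k) (H₀ : Matrix (Fin k) (Fin n) F)
    (H₁ : Matrix (Fin l) (Fin n) F) {d d₀ d₁ : ℕ} (hd : d ≤ d₀ + d₁)
    (h₀ : ∀ x, x ≠ 0 → H₀.mulVec x = 0 → d₀ ≤ hammingNorm x)
    (h₁ : ∀ x, x ≠ 0 → H₁.mulVec x = 0 → d₁ ≤ hammingNorm x)
    (h : ∀ x, x ≠ 0 → H₀.mulVec x = 0 → H₁.mulVec x = 0 → d ≤ hammingNorm x)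
    {u : Fin n → F[X]} (hu : u ∈ dualCode (generatedCode (unitMemoryMatrix H₀ H₁)))
    (hu0 : u ≠ 0) : d ≤ weight u := by
  rw [mem_dualCode_iff] at hu
  have hsucc (m : ℕ) (r : Fin k) := coeff_parityMatrix_mulVec_succ H₀ H₁ u r m
  have hzero (r : Fin k) := coeff_parityMatrix_mulVec_zero H₀ H₁ u r
  simp only [hu, Pi.zero_apply, coeff_zero] at hsucc hzero
  let S : Finset ℕ := Finset.univ.biUnion fun j => (u j).support
  have hS (m : ℕ) : m ∈ S ↔ (fun j => (u j).coeff m) ≠ 0 := by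
    simp [S, funext_iff]
  have hne : S.Nonempty := by
    obtain ⟨j, hj⟩ := Function.ne_iff.1 hu0
    obtain ⟨m, hm⟩ := nonempty_support_iff.2 hj
    exact ⟨m, Finset.mem_biUnion.2 ⟨j, Finset.mem_univ _, hm⟩⟩
  have hvan (m : ℕ) (hm : m ∉ S) : (fun j => (u j).coeff m) = 0 := by
    rwa [hS, not_not] at hm
  -- The recursion `H₀ u_m + H̃₁ u_{m+1} = 0` loses its second term at the top index and, below, its
  -- first term at the bottom index.
  have hlast : H₀.mulVec (fun j => (u j).coeff (S.max' hne)) = 0 := by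
    ext r
    have hm : S.max' hne + 1 ∉ S := fun hm => absurd (S.le_max' _ hm) (by omega)
    simpa [hvan _ hm] using (hsucc (S.max' hne) r).symm
  have hfirst : H₁.mulVec (fun j => (u j).coeff (S.min' hne)) = 0 := by
    rw [← padRows_mulVec_eq_zero_iff hl]
    intro r
    rcases hm : S.min' hne with _ | m
    · exact (hzero r).symm
    · have hm' : m ∉ S := fun hm' => absurd (S.min'_le _ hm') (by omega)
      simpa [hvan _ hm'] using (hsucc m r).symm
  have ha := (hS _).1 (S.min'_mem hne)
  have hb := (hS _).1 (S.max'_mem hne)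
  by_cases hab : S.min' hne = S.max' hne
  · rw [← hab] at hlast
    refine (h _ ha hlast hfirst).trans ?_
    simpa using sum_hammingNorm_coeff_le_weight u {S.min' hne}
  · have := sum_hammingNorm_coeff_le_weight u {S.min' hne, S.max' hne}
    rw [Finset.sum_pair hab] at this
    have := h₀ _ hb hlast
    have := h₁ _ ha hfirst
    omega

open Classical in
/-- The BCH bound: a nonzero word whose transform vanishes at `r` consecutive powers of pairwise
distinct nonzero `x j` has more than `r` nonzero entries. -/
theorem lt_hammingNorm_of_sum_eq_zero {K : Type*} [Field K] {x : Fin n → K}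
    (hx : Function.Injective x) (hx0 : ∀ j, x j ≠ 0) {c : Fin n → K} (hc : c ≠ 0) (b r : ℕ)
    (h : ∀ i < r, ∑ j, c j * x j ^ (b + i) = 0) : r < hammingNorm c := by
  by_contra! hr
  obtain ⟨j₀, hj₀⟩ := Function.ne_iff.1 hc
  have hp : ∀ p : K[X], p.natDegree < r → ∑ j, c j * x j ^ b * p.eval (x j) = 0 := by
    intro p hp
    simp only [eval_eq_sum_range' hp, Finset.mul_sum]
    rw [Finset.sum_comm]
    refine Finset.sum_eq_zero fun i hi => ?_
    rw [← mul_zero (p.coeff i), ← h i (Finset.mem_range.1 hi), Finset.mul_sum]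
    exact Finset.sum_congr rfl fun j _ => by ring
  let s : Finset (Fin n) := (Finset.univ.filter fun j => c j ≠ 0).erase j₀
  have hs : s.card + 1 = hammingNorm c :=
    Finset.card_erase_add_one (Finset.mem_filter.2 ⟨Finset.mem_univ _, hj₀⟩)
  -- This polynomial vanishes at every point of the support except `x j₀`, and has degree one less
  -- than the weight, so the vanishing sum reduces to its `j₀` term.
  have h0 := hp (∏ j ∈ s, (X - C (x j))) (by
    rw [natDegree_prod_of_monic _ _ fun j _ => monic_X_sub_C _]
    simp only [natDegree_X_sub_C, Finset.sum_const, smul_eq_mul, mul_one]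
    omega)
  rw [Finset.sum_eq_single j₀] at h0
  · simp only [eval_prod, mul_eq_zero, pow_eq_zero_iff', Finset.prod_eq_zero_iff] at h0
    rcases h0 with (h0 | h0) | ⟨j, hj, h0⟩
    · exact hj₀ h0
    · exact hx0 _ h0.1
    · have : j₀ = j := hx (by simpa [sub_eq_zero] using h0)
      exact Finset.notMem_erase j₀ _ (this ▸ hj)
  · intro j _ hj
    by_cases hcj : c j = 0
    · simp [hcj]
    · rw [eval_prod, Finset.prod_eq_zero (i := j) (by simp [s, hj, hcj]) (by simp), mul_zero]
  · simp

end Distance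

/-! ### Reduced basic generator matrix of the dual -/

section Reduced

variable {F : Type*} [Field F] {k l n : ℕ}

theorem natDegree_det_le {ι : Type*} [Fintype ι] [DecidableEq ι] {R : Type*} [CommRing R]
    (M : Matrix ι ι R[X]) (d : ι → ℕ) (h : ∀ i j, (M i j).natDegree ≤ d i) :
    M.det.natDegree ≤ ∑ i, d i := by
  rw [← Matrix.det_transpose, Matrix.det_apply]
  refine natDegree_sum_le_of_forall_le _ _ fun σ _ => ?_
  refine (natDegree_smul_le _ _).trans ((natDegree_prod_le _ _).trans ?_)
  exact Finset.sum_le_sum fun i _ => h _ _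

theorem natDegree_mul_map_C_le {ι κ : Type*} [Fintype κ] {m : Type*} (M : Matrix m κ F[X])
    (A : Matrix κ ι F) {i : m} {d : ℕ} (h : ∀ j, (M i j).natDegree ≤ d) (j : ι) :
    ((M * A.map C) i j).natDegree ≤ d := by
  rw [Matrix.mul_apply]
  refine natDegree_sum_le_of_forall_le _ _ fun a _ => ?_
  exact (natDegree_mul_C_le _ _).trans (h a)

theorem natDegree_le_rowDegree (G : Matrix (Fin k) (Fin n) F[X]) (i : Fin k) (j : Fin n) :
    (G i j).natDegree ≤ rowDegree G i :=
  Finset.le_sup (f := fun j => (G i j).natDegree) (Finset.mem_univ j)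

theorem exists_mul_eq_of_generatedCode_le {G G' : Matrix (Fin k) (Fin n) F[X]}
    (h : generatedCode G' ≤ generatedCode G) : ∃ T : Matrix (Fin k) (Fin k) F[X], T * G = G' := by
  have (i : Fin k) : ∃ w : Fin k → F[X], Matrix.vecMul w G = G' i := by
    have : G' i ∈ generatedCode G := h ⟨Pi.single i 1, by simp [Matrix.row]⟩
    simpa [generatedCode] using this
  choose T hT using this
  exact ⟨Matrix.of T, by funext i; rw [Matrix.mul_apply_eq_vecMul]; exact hT i⟩

/-- The degree of a maximal minor of `G A`, with `A` constant, bounds from below the overall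
constraint length of every generator matrix of the code of a basic matrix `G`. -/
theorem natDegree_det_le_constraintLength {G G' : Matrix (Fin k) (Fin n) F[X]} (hG : IsBasic G)
    (h : generatedCode G' = generatedCode G) (A : Matrix (Fin n) (Fin k) F) :
    (G * A.map C).det.natDegree ≤ constraintLength G' := by
  obtain ⟨T, hT⟩ := exists_mul_eq_of_generatedCode_le h.le
  obtain ⟨S, hS⟩ := exists_mul_eq_of_generatedCode_le h.ge
  obtain ⟨R, hR⟩ := hG
  -- The right inverse cancels `G` in `S T G = G`.
  have hST : S * T = 1 := by
    rw [← Matrix.mul_one (S * T), ← hR, ← Matrix.mul_assoc, Matrix.mul_assoc S, hT, hS, hR]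
  have hdet : T.det ≠ 0 := fun h0 => by simpa [h0] using congrArg Matrix.det hST
  have := natDegree_det_le (G' * A.map C) (rowDegree G')
    fun i j => natDegree_mul_map_C_le _ _ (natDegree_le_rowDegree G' i) j
  refine le_trans ?_ this
  rw [← hT, Matrix.mul_assoc, Matrix.det_mul T]
  by_cases h0 : (G * A.map C).det = 0
  · simp [h0]
  · rw [natDegree_mul hdet h0]
    omega

/-- The generator matrix, in coordinates adapted to the rows of `H₀` and `H₁`, of the kernel of
`H₀ D + H̃₁`. -/
noncomputable def kernelMatrix (F : Type*) [Field F] (κ : Type*) [DecidableEq κ] (hl : l ≤ k) :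
    Matrix (Fin l ⊕ κ) ((Fin k ⊕ Fin l) ⊕ κ) F[X] :=
  Matrix.fromBlocks
    (Matrix.fromCols ((1 : Matrix (Fin k) (Fin k) F[X]).submatrix (Fin.castLE hl) id)
      (Matrix.diagonal fun _ => -X)) 0 0 1

section kernelMatrix

variable {κ : Type*} [DecidableEq κ] (hl : l ≤ k)

theorem vecMul_submatrix_castLE (w : Fin l → F[X]) (r : Fin k) :
    Matrix.vecMul w ((1 : Matrix (Fin k) (Fin k) F[X]).submatrix (Fin.castLE hl) id) r =
      if h : (r : ℕ) < l then w ⟨r, h⟩ else 0 := by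
  simp only [Matrix.vecMul, dotProduct, Matrix.submatrix_apply, id, Matrix.one_apply, mul_ite,
    mul_one, mul_zero]
  split_ifs with h
  · rw [Finset.sum_eq_single ⟨r, h⟩]
    · simp
    · intro i _ hi
      rw [if_neg]
      rintro rfl
      exact hi rfl
    · simp
  · refine Finset.sum_eq_zero fun i _ => if_neg ?_
    rintro rfl
    exact h i.2

/-- The first `l` coordinates and those in `κ` are free; the equations determine the `Fin l` block
as `-X` times the former, and kill the other `Fin k` coordinates. -/
theorem exists_vecMul_kernelMatrix_iff [Fintype κ] (x : (Fin k ⊕ Fin l) ⊕ κ → F[X]) :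
    (∃ w, Matrix.vecMul w (kernelMatrix F κ hl) = x) ↔
      ∀ r : Fin k, X * x (.inl (.inl r)) +
        (if h : (r : ℕ) < l then x (.inl (.inr ⟨r, h⟩)) else 0) = 0 := by
  constructor
  · rintro ⟨w, rfl⟩ r
    simp only [kernelMatrix, Matrix.vecMul_fromBlocks, Matrix.vecMul_fromCols, Sum.elim_inl,
      Matrix.vecMul_zero, add_zero, vecMul_submatrix_castLE, Matrix.vecMul_diagonal,
      Sum.elim_inr]
    split_ifs <;> simp [mul_comm]
  · intro h
    refine ⟨Sum.elim (fun i => x (.inl (.inl (i.castLE hl)))) fun c => x (.inr c), ?_⟩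
    funext i
    rcases i with (r | i) | c
    · simp only [kernelMatrix, Matrix.vecMul_fromBlocks, Matrix.vecMul_fromCols, Sum.elim_inl,
        Matrix.vecMul_zero, add_zero, Sum.elim_comp_inl, vecMul_submatrix_castLE]
      split_ifs with hr
      · rfl
      · have := h r
        rw [dif_neg hr, add_zero] at this
        exact ((mul_eq_zero.1 this).resolve_left X_ne_zero).symm
    · have := h (i.castLE hl)
      simp only [Fin.val_castLE, Fin.is_lt, dite_true, Fin.eta] at this
      simp only [kernelMatrix, Matrix.vecMul_fromBlocks, Matrix.vecMul_fromCols, Sum.elim_inl,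
        Matrix.vecMul_zero, add_zero, Sum.elim_comp_inl, Sum.elim_inr, Matrix.vecMul_diagonal]
      linear_combination -this
    · simp [kernelMatrix, Matrix.vecMul_fromBlocks]

/-- The columns of the free coordinates supply a polynomial right inverse. -/
theorem kernelMatrix_submatrix_eq_one :
    (kernelMatrix F κ hl).submatrix id (Sum.map (Sum.inl ∘ Fin.castLE hl) id) = 1 := by
  ext1 i j
  rcases i with i | i <;> rcases j with j | j <;>
    simp [kernelMatrix, Matrix.one_apply]

/-- A maximal minor whose degree `l` matches the sum of the row degrees, which certifies minimality.
-/
theorem det_kernelMatrix_submatrix [Fintype κ] :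
    ((kernelMatrix F κ hl).submatrix id (Sum.map Sum.inr id)).det = (-X) ^ l := by
  have : (kernelMatrix F κ hl).submatrix id (Sum.map Sum.inr id) =
      Matrix.fromBlocks (Matrix.diagonal fun _ => -X) 0 0 1 := by
    ext1 i j
    rcases i with i | i <;> rcases j with j | j <;> simp [kernelMatrix]
  rw [this, Matrix.det_fromBlocks_zero₂₁]
  simp

theorem natDegree_kernelMatrix_le (i : Fin l ⊕ κ) (j : (Fin k ⊕ Fin l) ⊕ κ) :
    (kernelMatrix F κ hl i j).natDegree ≤ Sum.elim (fun _ => 1) (fun _ => 0) i := by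
  rcases i with i | i <;> rcases j with (j | j) | j <;>
    simp only [kernelMatrix, Matrix.fromBlocks_apply₁₁, Matrix.fromBlocks_apply₁₂,
      Matrix.fromBlocks_apply₂₁, Matrix.fromBlocks_apply₂₂, Matrix.fromCols_apply_inl,
      Matrix.fromCols_apply_inr, Matrix.submatrix_apply, Matrix.one_apply, Matrix.diagonal_apply,
      Matrix.zero_apply, Sum.elim_inl, Sum.elim_inr] <;>
    (try split_ifs) <;> simp

end kernelMatrix

theorem sumExtend_inl {ι V : Type*} [AddCommGroup V] [Module F V] {v : ι → V}
    (hv : LinearIndependent F v) (i : ι) : Module.Basis.sumExtend hv (.inl i) = v i := by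
  simp only [Module.Basis.sumExtend, Module.Basis.reindex_apply, Module.Basis.extend_apply_self]
  rfl

/-- If the rows of `H₀` and `H₁` are jointly linearly independent, then the dual of the code
generated by `H₀ + H̃₁ D` is a unit memory code with overall constraint length the number of rows
of `H₁`. -/
theorem exists_isReducedBasic_generatedCode_eq_dualCode {k' : ℕ} (hk' : k' + k = n) (hl : l ≤ k)
    (hl0 : 1 ≤ l) (H₀ : Matrix (Fin k) (Fin n) F) (H₁ : Matrix (Fin l) (Fin n) F)
    (hind : LinearIndependent F (Sum.elim H₀.row H₁.row)) :
    ∃ G : Matrix (Fin k') (Fin n) F[X], IsReducedBasic G ∧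
      generatedCode G = dualCode (generatedCode (unitMemoryMatrix H₀ H₁)) ∧
      constraintLength G = l ∧ memory G = 1 := by
  classical
  let b := Module.Basis.sumExtend hind
  have hfin : Finite ((Fin k ⊕ Fin l) ⊕ Module.Basis.sumExtendIndex hind) :=
    Module.Finite.finite_basis b
  have : Finite (Module.Basis.sumExtendIndex hind) := Finite.sum_right (Fin k ⊕ Fin l)
  have := Fintype.ofFinite (Module.Basis.sumExtendIndex hind)
  have hcard : k + l + Fintype.card (Module.Basis.sumExtendIndex hind) = n := by
    simpa using (Module.finrank_eq_card_basis b).symm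
  obtain ⟨e⟩ : Nonempty (Fin k' ≃ Fin l ⊕ Module.Basis.sumExtendIndex hind) := by
    rw [← Fintype.card_eq]
    simp only [Fintype.card_fin, Fintype.card_sum]
    omega
  -- `u U` lists the dot products of `u` with the basis vectors, so its first entries are `H₀ u` and
  -- `H₁ u`; `V` is the inverse change of coordinates.
  let U := (Pi.basisFun F (Fin n)).toMatrix b
  let V := b.toMatrix (Pi.basisFun F (Fin n))
  have hUV : U.map (C : F →+* F[X]) * V.map C = 1 := by
    rw [← Matrix.map_mul, Module.Basis.toMatrix_mul_toMatrix_flip, Matrix.map_one _ C_0 C_1]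
  have hVU : V.map (C : F →+* F[X]) * U.map C = 1 := by
    rw [← Matrix.map_mul, Module.Basis.toMatrix_mul_toMatrix_flip, Matrix.map_one _ C_0 C_1]
  let N := (kernelMatrix F (Module.Basis.sumExtendIndex hind) hl).submatrix e id
  have hNU (s : Fin k' → _) : N * V.map C * (U.submatrix id s).map C = N.submatrix id s := by
    have : (U.submatrix id s).map (C : F →+* F[X]) = (U.map C).submatrix id s := rfl
    have h : (1 : Matrix _ _ F[X]).submatrix id s = V.map C * (U.map C).submatrix id s := by
      rw [← hVU, Matrix.submatrix_mul _ _ id id s Function.bijective_id, Matrix.submatrix_id_id]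
    rw [this, Matrix.mul_assoc, ← h]
    have := Matrix.submatrix_mul N 1 id id s Function.bijective_id
    rwa [Matrix.mul_one, Matrix.submatrix_id_id, eq_comm] at this
  have hbasic : IsBasic (N * V.map C) := by
    refine ⟨(U.submatrix id (Sum.map (Sum.inl ∘ Fin.castLE hl) id ∘ e)).map C, ?_⟩
    rw [hNU]
    have := congrArg (fun M => M.submatrix e e) (kernelMatrix_submatrix_eq_one (F := F)
      (κ := Module.Basis.sumExtendIndex hind) hl)
    simpa [N] using this
  have hmin (G' : Matrix (Fin k') (Fin n) F[X])
      (h : generatedCode G' = generatedCode (N * V.map C)) : l ≤ constraintLength G' := by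
    have hdeg := natDegree_det_le_constraintLength hbasic h
      (U.submatrix id (Sum.map Sum.inr id ∘ e))
    have hdet : (N.submatrix id (Sum.map Sum.inr id ∘ e)).det = (-X : F[X]) ^ l := by
      rw [← det_kernelMatrix_submatrix (F := F) (κ := Module.Basis.sumExtendIndex hind) hl,
        ← Matrix.det_submatrix_equiv_self e]
      rfl
    rwa [hNU, hdet, natDegree_pow, natDegree_neg, natDegree_X, mul_one] at hdeg
  have hrow (i : Fin k') : rowDegree (N * V.map C) i ≤ Sum.elim (fun _ => 1) (fun _ => 0) (e i) :=
    Finset.sup_le fun j _ =>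
      natDegree_mul_map_C_le _ _ (fun a => natDegree_kernelMatrix_le hl (e i) a) j
  have hlen : constraintLength (N * V.map C) = l := by
    refine le_antisymm ((Finset.sum_le_sum fun i _ => hrow i).trans ?_) (hmin _ rfl)
    rw [e.sum_comp (Sum.elim (fun _ => 1) fun _ => 0)]
    simp
  refine ⟨N * V.map C, ⟨hbasic, fun G' _ h => hlen.le.trans (hmin G' h)⟩, ?_, hlen, ?_⟩
  · ext u : 1
    rw [mem_dualCode_iff]
    let x := Matrix.vecMul u (U.map C)
    have hx : Matrix.vecMul x (V.map C) = u := by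
      rw [Matrix.vecMul_vecMul, hUV, Matrix.vecMul_one]
    have h1 : u ∈ generatedCode (N * V.map C) ↔
        ∃ w, Matrix.vecMul w (kernelMatrix F (Module.Basis.sumExtendIndex hind) hl) = x := by
      constructor
      · rintro ⟨w, rfl⟩
        refine ⟨w ∘ e.symm, ?_⟩
        simp only [x, Matrix.vecMulLinear_apply]
        rw [Matrix.vecMul_vecMul, Matrix.mul_assoc, hVU, Matrix.mul_one,
          Matrix.submatrix_vecMul_equiv]
        rfl
      · rintro ⟨w, hw⟩
        refine ⟨w ∘ e, ?_⟩
        rw [Matrix.vecMulLinear_apply, ← Matrix.vecMul_vecMul, Matrix.submatrix_vecMul_equiv, ← hx,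
          ← hw, Function.comp_assoc, e.self_comp_symm]
        rfl
    rw [h1, exists_vecMul_kernelMatrix_iff, funext_iff]
    refine forall_congr' fun r => ?_
    have h2 : (parityMatrix H₀ H₁).mulVec u r = X * x (.inl (.inl r)) +
        (if h : (r : ℕ) < l then x (.inl (.inr ⟨r, h⟩)) else 0) := by
      simp only [x, Matrix.mulVec, Matrix.vecMul, dotProduct, parityMatrix, Matrix.of_apply,
        add_mul, Finset.sum_add_distrib, Finset.mul_sum, U, Module.Basis.toMatrix_apply,
        Pi.basisFun_repr, b, Matrix.map_apply, padRows]
      congr 1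
      · refine Finset.sum_congr rfl fun j _ => ?_
        have : Module.Basis.sumExtend hind (.inl (.inl r)) = H₀ r := sumExtend_inl hind _
        rw [this]
        ring
      · split_ifs with hr
        · refine Finset.sum_congr rfl fun j _ => ?_
          have : Module.Basis.sumExtend hind (.inl (.inr ⟨r, hr⟩)) = H₁ ⟨r, hr⟩ := sumExtend_inl hind _
          rw [this]
          ring
        · simp
    rw [h2]
    rfl
  · refine le_antisymm (Finset.sup_le fun i _ => (hrow i).trans ?_) ?_
    · rcases e i with _ | _ <;> simp
    -- Memory `0` would make the overall constraint length `0`, against `1 ≤ l`.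
    · by_contra! h0
      have : constraintLength (N * V.map C) = 0 := Finset.sum_eq_zero fun i hi => by
        have := Finset.le_sup (f := fun i => rowDegree (N * V.map C) i) hi
        unfold memory at h0
        omega
      omega

end Reduced

/-! ### Ranks of the expanded matrices -/

section Rank

variable {F : Type*} [Field F] {K : Type*} [Field K] [Algebra F K] {k l n m : ℕ}

theorem bchMatrix_mulVec (B : Module.Basis (Fin m) F K) (α : K) (b r : ℕ) (u : Fin n → F)
    (i : Fin r × Fin m) : (bchMatrix B α b r n).mulVec u i =
      B.repr (∑ j, algebraMap F K (u j) * α ^ ((b + i.1) * (j : ℕ))) i.2 := by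
  simp only [← Algebra.smul_def, map_sum, map_smul, Finsupp.coe_finsetSum, Finset.sum_apply,
    Finsupp.smul_apply, smul_eq_mul, bchMatrix, Matrix.mulVec, dotProduct, Matrix.of_apply]
  exact Finset.sum_congr rfl fun j _ => mul_comm _ _

theorem bchMatrix_mulVec_eq_zero_iff (B : Module.Basis (Fin m) F K) (α : K) (b r : ℕ)
    (u : Fin n → F) : (bchMatrix B α b r n).mulVec u = 0 ↔
      ∀ i < r, ∑ j, algebraMap F K (u j) * (α ^ (j : ℕ)) ^ (b + i) = 0 := by
  simp only [← pow_mul, mul_comm]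
  constructor
  · intro h i hi
    refine B.repr.map_eq_zero_iff.1 (Finsupp.ext fun t => ?_)
    have := congrFun h (⟨i, hi⟩, t)
    rw [bchMatrix_mulVec] at this
    simpa [mul_comm] using this
  · intro h
    ext i
    rw [bchMatrix_mulVec]
    have := h i.1 i.1.2
    simp only [mul_comm] at this ⊢
    simp [this]

theorem mulVec_eq_zero_of_span_row_le {ι κ : Type*} {A : Matrix ι (Fin n) F}
    {H : Matrix κ (Fin n) F}
    (h : Submodule.span F (Set.range A.row) ≤ Submodule.span F (Set.range H.row))
    {u : Fin n → F} (hu : H.mulVec u = 0) : A.mulVec u = 0 := by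
  have hle : Submodule.span F (Set.range H.row) ≤
      LinearMap.ker (Fintype.linearCombination F u) := by
    rw [Submodule.span_le]
    rintro _ ⟨i, rfl⟩
    simpa [Fintype.linearCombination_apply, Matrix.mulVec, dotProduct] using congrFun hu i
  ext i
  simpa [Fintype.linearCombination_apply, Matrix.mulVec, dotProduct] using
    hle (h (Submodule.subset_span ⟨i, rfl⟩))

/-- If the first power of `α` has entries in the base field, it contributes only one dimension to
the row space of the expanded matrix. -/
theorem finrank_span_bchMatrix_le (B : Module.Basis (Fin 2) F K) (α : K) (b r : ℕ) (f : Fin n → F)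
    (hf : ∀ j : Fin n, α ^ (b * (j : ℕ)) = algebraMap F K (f j)) :
    Module.finrank F (Submodule.span F (Set.range (bchMatrix B α b (r + 1) n).row)) ≤
      2 * r + 1 := by
  let g : Option (Fin r × Fin 2) → Fin n → F := fun i =>
    i.elim f fun i => (bchMatrix B α b (r + 1) n).row (i.1.succ, i.2)
  have hle : Submodule.span F (Set.range (bchMatrix B α b (r + 1) n).row) ≤
      Submodule.span F (Set.range g) := by
    rw [Submodule.span_le]
    rintro _ ⟨⟨i, t⟩, rfl⟩
    rcases Fin.eq_zero_or_eq_succ i with rfl | ⟨i, rfl⟩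
    · have : (bchMatrix B α b (r + 1) n).row (0, t) = B.repr 1 t • g none := by
        ext j
        simp [bchMatrix, g, Matrix.row, hf, Algebra.algebraMap_eq_smul_one, mul_comm]
      rw [this]
      exact Submodule.smul_mem _ _ (Submodule.subset_span ⟨none, rfl⟩)
    · exact Submodule.subset_span ⟨some (i, t), rfl⟩
  refine (Submodule.finrank_mono hle).trans ((finrank_range_le_card g).trans ?_)
  simp [mul_comm]

/-- Extension of scalars of vectors. -/
theorem finrank_span_algebraMap_le (W : Submodule F (Fin n → F)) :
    Module.finrank K (Submodule.span K ((fun w : Fin n → F => algebraMap F K ∘ w) '' W)) ≤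
      Module.finrank F W := by
  let b := Module.finBasis F W
  have hle : Submodule.span K ((fun w : Fin n → F => algebraMap F K ∘ w) '' W) ≤
      Submodule.span K (Set.range fun i => algebraMap F K ∘ (b i : Fin n → F)) := by
    rw [Submodule.span_le]
    rintro _ ⟨w, hw, rfl⟩
    have : algebraMap F K ∘ w =
        ∑ i, algebraMap F K (b.repr ⟨w, hw⟩ i) • (algebraMap F K ∘ (b i : Fin n → F)) := by
      have h := congrArg Subtype.val (b.sum_repr ⟨w, hw⟩)
      ext j
      have h := congrFun h j
      simp only [Submodule.coe_sum, Submodule.coe_smul, Finset.sum_apply, Pi.smul_apply,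
        smul_eq_mul] at h
      simp [← h, Algebra.smul_def]
    simp only [this]
    exact Submodule.sum_mem _ fun i _ => Submodule.smul_mem _ _ (Submodule.subset_span ⟨i, rfl⟩)
  refine (Submodule.finrank_mono hle).trans ((finrank_range_le_card _).trans ?_)
  simp

theorem linearIndependent_pow_mul {α : K} (hα : IsPrimitiveRoot α n) :
    LinearIndependent K fun t : Fin n => fun j : Fin n => α ^ ((t : ℕ) * (j : ℕ)) := by
  have h := Matrix.linearIndependent_rows_of_det_ne_zero
    (A := Matrix.vandermonde fun t : Fin n => α ^ (t : ℕ))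
    (Matrix.det_vandermonde_ne_zero_iff.2 fun s t hst => Fin.ext (hα.pow_inj s.2 t.2 hst))
  simp only [Matrix.vandermonde, ← pow_mul] at h
  exact h

/-- Distinct exponents below `n` give independent Vandermonde rows, and extending scalars does not
raise the dimension. -/
theorem card_le_finrank_of_pow_mem {α : K} (hα : IsPrimitiveRoot α n) (T : Finset ℕ)
    (W : Submodule F (Fin n → F)) (hT : ∀ t ∈ T, t < n)
    (h : ∀ t ∈ T, (fun j : Fin n => α ^ (t * (j : ℕ))) ∈
      Submodule.span K ((fun w : Fin n → F => algebraMap F K ∘ w) '' W)) :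
    T.card ≤ Module.finrank F W := by
  refine le_trans ?_ (finrank_span_algebraMap_le (K := K) W)
  have hind := (linearIndependent_pow_mul hα).comp (fun t : T => (⟨t, hT t t.2⟩ : Fin n))
    fun s t hst => Subtype.ext (by simpa using hst)
  rw [← Fintype.card_coe T, ← finrank_span_eq_card hind]
  refine Submodule.finrank_mono (Submodule.span_le.2 ?_)
  rintro _ ⟨t, rfl⟩
  exact h t t.2

/-- Applying `φ` to the expansion in `B` leaves the coordinates unchanged. Taking `φ` to be the
identity or Frobenius recovers both a power vector and its conjugate. -/
theorem map_pow_mem_span (B : Module.Basis (Fin m) F K) (α : K) (b r : ℕ)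
    (φ : K →ₗ[F] K) {i : ℕ} (hi : i < r) {W : Submodule F (Fin n → F)}
    (hW : Submodule.span F (Set.range (bchMatrix B α b r n).row) ≤ W) :
    (fun j : Fin n => φ (α ^ ((b + i) * (j : ℕ)))) ∈
      Submodule.span K ((fun w : Fin n → F => algebraMap F K ∘ w) '' W) := by
  have : (fun j : Fin n => φ (α ^ ((b + i) * (j : ℕ)))) =
      ∑ t, φ (B t) • (algebraMap F K ∘ (bchMatrix B α b r n).row (⟨i, hi⟩, t)) := by
    ext j
    conv_lhs => rw [← B.sum_repr (α ^ ((b + i) * (j : ℕ)))]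
    simp only [map_sum, map_smul, Finset.sum_apply, Pi.smul_apply, Function.comp_apply]
    exact Finset.sum_congr rfl fun t _ => (Algebra.smul_def _ _).trans (mul_comm _ _)
  rw [this]
  exact Submodule.sum_mem _ fun t _ => Submodule.smul_mem _ _
    (Submodule.subset_span ⟨_, hW (Submodule.subset_span ⟨_, rfl⟩), rfl⟩)

/-- `X^q - X` already splits over `F`, so it acquires no new roots in `K`. -/
theorem mem_range_algebraMap_of_pow_card_eq [Fintype F] {x : K} (hx : x ^ Fintype.card F = x) :
    ∃ y, algebraMap F K y = x := by
  have hs : Splits (X ^ Fintype.card F - X : F[X]) := by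
    rw [splits_iff_card_roots, FiniteField.roots_X_pow_card_sub_X,
      FiniteField.X_pow_card_sub_X_natDegree_eq _ Fintype.one_lt_card]
    rfl
  have hroots := hs.roots_map (algebraMap F K)
  rw [FiniteField.roots_X_pow_card_sub_X] at hroots
  have h0 : (X ^ Fintype.card F - X : K[X]) ≠ 0 :=
    FiniteField.X_pow_card_sub_X_ne_zero _ Fintype.one_lt_card
  have hmem : x ∈ (map (algebraMap F K) (X ^ Fintype.card F - X)).roots := by
    simp [h0, hx]
  rw [hroots] at hmem
  simpa using hmem

theorem exists_pow_succ_card_mul_eq [Fintype F] {q : ℕ} (hq : Fintype.card F = q) {α : K}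
    (hα : α ^ (q ^ 2 - 1) = 1) (j : ℕ) : ∃ y, algebraMap F K y = α ^ ((q + 1) * j) := by
  apply mem_range_algebraMap_of_pow_card_eq
  have hq0 : 0 < q := hq ▸ Fintype.card_pos
  have h1 : 1 ≤ q ^ 2 := Nat.one_le_pow _ _ hq0
  have h : (q + 1) * j * q = (q ^ 2 - 1) * j + (q + 1) * j := by
    zify [h1]
    ring
  rw [hq, ← pow_mul, h, pow_add, pow_mul, hα, one_pow, one_mul]

/-- Exponents of `α` representing the conjugacy classes of `0, …, q - 1` and `q + 1, …, 2q - 1`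
under multiplication by `q` modulo `q ^ 2 - 1`. -/
def conjugateExponents (q : ℕ) : Finset ℕ :=
  Finset.range (2 * q) ∪
    ((Finset.Ico 2 q).image (q * ·) ∪ (Finset.Ico 2 q).image (q * · + 1))

theorem card_conjugateExponents {q : ℕ} (hq : 2 ≤ q) :
    (conjugateExponents q).card = 4 * q - 4 := by
  have h1 : Set.InjOn (q * ·) (Finset.Ico 2 q : Set ℕ) := fun a _ b _ h =>
    Nat.eq_of_mul_eq_mul_left (by omega) h
  have h2 : Set.InjOn (q * · + 1) (Finset.Ico 2 q : Set ℕ) := fun a _ b _ h =>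
    Nat.eq_of_mul_eq_mul_left (by omega) (Nat.succ_injective h)
  rw [conjugateExponents, Finset.card_union_of_disjoint, Finset.card_union_of_disjoint,
    Finset.card_image_of_injOn h1, Finset.card_image_of_injOn h2]
  · simp
    omega
  · simp only [Finset.disjoint_left, Finset.mem_image, not_exists, not_and]
    rintro _ ⟨a, -, rfl⟩ b - h
    have := congrArg (· % q) h
    simp [Nat.mod_eq_of_lt (show 1 < q by omega)] at this
  · simp only [Finset.disjoint_left, Finset.mem_range, Finset.mem_union, Finset.mem_image,
      Finset.mem_Ico]
    rintro a ha (⟨b, hb, rfl⟩ | ⟨b, hb, rfl⟩) <;> nlinarith [hb.1]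

theorem lt_of_mem_conjugateExponents {q t : ℕ} (hq : 3 ≤ q) (ht : t ∈ conjugateExponents q) :
    t < q ^ 2 - 1 := by
  simp only [conjugateExponents, Finset.mem_range, Finset.mem_union, Finset.mem_image,
      Finset.mem_Ico] at ht
  apply Nat.lt_sub_of_add_lt
  rcases ht with ht | ⟨b, hb, rfl⟩ | ⟨b, hb, rfl⟩
  · nlinarith
  · nlinarith [hb.2]
  · nlinarith [hb.2]

/-- The number of rows of the two parity check matrices, and their joint independence. -/
theorem rowSelection_ranks [Fintype F] {q : ℕ} (hF : Fintype.card F = q) (hq : 4 ≤ q)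
    (hn : n = q ^ 2 - 1) (B : Module.Basis (Fin 2) F K) {α : K} (hα : IsPrimitiveRoot α n)
    {H₀ : Matrix (Fin k) (Fin n) F} {H₁ : Matrix (Fin l) (Fin n) F}
    (h₀ : IsRowSelection (bchMatrix B α 0 q n) H₀)
    (h₁ : IsRowSelection (bchMatrix B α (q + 1) (q - 1) n) H₁) :
    k = 2 * q - 1 ∧ l = 2 * q - 3 ∧ LinearIndependent F (Sum.elim H₀.row H₁.row) := by
  obtain ⟨-, hi₀, hs₀⟩ := h₀
  obtain ⟨-, hi₁, hs₁⟩ := h₁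
  have hpow : α ^ (q ^ 2 - 1) = 1 := hn ▸ hα.pow_eq_one
  have hk : k ≤ 2 * q - 1 := by
    have h := finrank_span_eq_card hi₀
    rw [Fintype.card_fin] at h
    have := finrank_span_bchMatrix_le (n := n) B α 0 (q - 1) 1 (by simp)
    rw [Nat.sub_add_cancel (by omega), ← hs₀, h] at this
    omega
  have hl : l ≤ 2 * q - 3 := by
    have h := finrank_span_eq_card hi₁
    rw [Fintype.card_fin] at h
    choose f hf using exists_pow_succ_card_mul_eq hF hpow
    have := finrank_span_bchMatrix_le (n := n) B α (q + 1) (q - 2) (fun j => f j)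
      (fun j => (hf j).symm)
    rw [show q - 2 + 1 = q - 1 by omega, ← hs₁, h] at this
    omega
  let W := Submodule.span F (Set.range (Sum.elim H₀.row H₁.row))
  have hW₀ : Submodule.span F (Set.range (bchMatrix B α 0 q n).row) ≤ W := by
    rw [← hs₀]
    exact Submodule.span_mono (by rw [Set.Sum.elim_range]; exact Set.subset_union_left)
  have hW₁ : Submodule.span F (Set.range (bchMatrix B α (q + 1) (q - 1) n).row) ≤ W := by
    rw [← hs₁]
    exact Submodule.span_mono (by rw [Set.Sum.elim_range]; exact Set.subset_union_right)
  have hW : (conjugateExponents q).card ≤ Module.finrank F W := by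
    refine card_le_finrank_of_pow_mem hα _ W
      (fun t ht => hn ▸ lt_of_mem_conjugateExponents (by omega) ht) fun t ht => ?_
    let φ : K →ₗ[F] K := (FiniteField.frobeniusAlgHom F K).toLinearMap
    have hφ (x : K) : φ x = x ^ q := by simp [φ, hF]
    have mem₀ (s : ℕ) (hs : s < q) := map_pow_mem_span (n := n) B α 0 q .id hs hW₀
    have mem₀' (s : ℕ) (hs : s < q) := map_pow_mem_span (n := n) B α 0 q φ hs hW₀
    have mem₁ (s : ℕ) (hs : s < q - 1) := map_pow_mem_span (n := n) B α (q + 1) (q - 1) .id hs hW₁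
    have mem₁' (s : ℕ) (hs : s < q - 1) := map_pow_mem_span (n := n) B α (q + 1) (q - 1) φ hs hW₁
    simp only [LinearMap.id_apply, hφ, zero_add, ← pow_mul] at mem₀ mem₀' mem₁ mem₁'
    simp only [conjugateExponents, Finset.mem_range, Finset.mem_union, Finset.mem_image,
      Finset.mem_Ico] at ht
    rcases ht with ht | ⟨s, hs, rfl⟩ | ⟨s, hs, rfl⟩
    · rcases lt_trichotomy t q with htq | rfl | htq
      · exact mem₀ t htq
      · simpa [mul_comm] using mem₀' 1 (by omega)
      · simpa [show q + 1 + (t - (q + 1)) = t by omega] using mem₁ (t - (q + 1)) (by omega)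
    · convert! mem₀' s hs.2 using 3
      ring
    -- The index `s - 1` stands for the exponent `q + s`, whose conjugate is `q² + qs ≡ qs + 1`
    -- modulo `q² - 1`.
    · convert! mem₁' (s - 1) (by omega) using 2 with j
      have h1 : 1 ≤ q ^ 2 := Nat.one_le_pow _ _ (by omega)
      have h : (q + 1 + (s - 1)) * (j : ℕ) * q = (q ^ 2 - 1) * j + (q * s + 1) * j := by
        zify [h1, show 1 ≤ s by omega]
        ring
      rw [h, pow_add _ (_ * _), pow_mul _ (_ - _), hpow, one_pow, one_mul]
  rw [card_conjugateExponents (by omega)] at hW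
  have hle : Module.finrank F W ≤ k + l := by
    exact (finrank_range_le_card (R := F) (Sum.elim H₀.row H₁.row)).trans (by simp)
  -- `4q - 4 ≤ k + l` together with the two upper bounds forces equality in both.
  refine ⟨by omega, by omega, ?_⟩
  rw [linearIndependent_iff_card_le_finrank_span]
  refine le_trans ?_ hW
  simp only [Fintype.card_sum, Fintype.card_fin]
  omega

end Rank

/-! ### Assembling the parameters and existence -/

section Parameters

variable {F : Type*} [Field F] {K : Type*} [Field K] [Algebra F K] {k l n : ℕ}

theorem exists_isRowSelection {ι : Type*} [Finite ι] (A : Matrix ι (Fin n) F) :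
    ∃ (k : ℕ) (H : Matrix (Fin k) (Fin n) F), IsRowSelection A H := by
  obtain ⟨κ, a, ha, hspan, hind⟩ := exists_linearIndependent' F A.row
  have : Finite κ := Finite.of_injective a ha
  let e := (Finite.equivFin κ).symm
  refine ⟨Nat.card κ, A.submatrix (a ∘ e) id, ⟨a ∘ e, rfl⟩, hind.comp e e.injective, ?_⟩
  rw [← hspan, ← e.surjective.range_comp]
  rfl

open Classical in
theorem lt_hammingNorm_of_pow_sum_eq_zero {α : K} (hα : IsPrimitiveRoot α n) {x : Fin n → F}
    (hx : x ≠ 0) (b r : ℕ)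
    (h : ∀ i < r, ∑ j, algebraMap F K (x j) * (α ^ (j : ℕ)) ^ (b + i) = 0) :
    r < hammingNorm x := by
  have hinj := (algebraMap F K).injective
  rw [← hammingNorm_comp (fun _ => algebraMap F K) (fun _ => hinj) fun _ => map_zero _]
  obtain ⟨j₀, hj₀⟩ := Function.ne_iff.1 hx
  have hα0 : α ≠ 0 := hα.ne_zero (NeZero.of_pos (j₀.pos)).ne
  convert! lt_hammingNorm_of_sum_eq_zero (x := fun j : Fin n => α ^ (j : ℕ))
    (fun i j hij => Fin.ext (hα.pow_inj i.2 j.2 hij)) (fun j => pow_ne_zero _ hα0) ?_ b r h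
  exact Function.ne_iff.2 ⟨j₀, by simpa using hj₀⟩

/-- The dual of the unit memory code defined by the two parity check matrices has the asserted
parameters. -/
theorem rowSelection_hasParameters [Fintype F] {q : ℕ} (hF : Fintype.card F = q) (hq : 4 ≤ q)
    (hn : n = q ^ 2 - 1) (B : Module.Basis (Fin 2) F K) {α : K} (hα : IsPrimitiveRoot α n)
    {H₀ : Matrix (Fin k) (Fin n) F} {H₁ : Matrix (Fin l) (Fin n) F}
    (h₀ : IsRowSelection (bchMatrix B α 0 q n) H₀)
    (h₁ : IsRowSelection (bchMatrix B α (q + 1) (q - 1) n) H₁) :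
    k = 2 * q - 1 ∧ l = 2 * q - 3 ∧ ∃ d : ℕ, 2 * q + 1 ≤ d ∧
      HasParameters (dualCode (generatedCode (unitMemoryMatrix H₀ H₁)))
        (n - 2 * q + 1) (2 * q - 3) 1 d := by
  classical
  obtain ⟨hk, hl, hind⟩ := rowSelection_ranks hF hq hn B hα h₀ h₁
  have hn1 : 2 * q ≤ q ^ 2 - 1 := by
    apply Nat.le_sub_of_add_le
    nlinarith
  obtain ⟨G, hred, hG, hlen, hmem⟩ := exists_isReducedBasic_generatedCode_eq_dualCode
    (k' := n - 2 * q + 1) (by omega) (by omega) (by omega) H₀ H₁ hind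
  refine ⟨hk, hl, _, ?_, ⟨G, hred, hG, hlen.trans hl, hmem⟩, rfl⟩
  obtain ⟨R, hR⟩ := hred.1
  -- The infimum of an empty set would be `0`, so a nonzero codeword is needed: row `0` of `G`,
  -- nonzero because `G` has a right inverse.
  refine le_csInf ⟨_, G 0, ?_, ?_, rfl⟩ ?_
  · rw [← hG]
    exact ⟨Pi.single 0 1, by simp [Matrix.row]⟩
  · intro h0
    have := congrFun (congrFun hR 0) 0
    rw [Matrix.mul_apply_eq_vecMul, h0, Matrix.zero_vecMul] at this
    simp at this
  rintro _ ⟨v, hv, hv0, rfl⟩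
  have ker₀ (x : Fin n → F) (hx : H₀.mulVec x = 0) (i : ℕ) (hi : i < q) :
      ∑ j, algebraMap F K (x j) * (α ^ (j : ℕ)) ^ i = 0 := by
    have := (bchMatrix_mulVec_eq_zero_iff B α 0 q x).1
      (mulVec_eq_zero_of_span_row_le h₀.2.2.ge hx) i hi
    rwa [zero_add] at this
  have ker₁ (x : Fin n → F) (hx : H₁.mulVec x = 0) := (bchMatrix_mulVec_eq_zero_iff B α _ _ x).1
    (mulVec_eq_zero_of_span_row_le h₁.2.2.ge hx)
  refine le_weight_of_mem_dualCode (d₀ := q + 1) (d₁ := q) (by omega) H₀ H₁ (by omega) ?_ ?_ ?_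
    hv hv0
  · intro x hx0 hx
    refine lt_hammingNorm_of_pow_sum_eq_zero hα hx0 0 q fun i hi => ?_
    rw [zero_add]
    exact ker₀ x hx i hi
  · intro x hx0 hx
    have := lt_hammingNorm_of_pow_sum_eq_zero hα hx0 (q + 1) (q - 1) (ker₁ x hx)
    omega
  · intro x hx0 hx hx'
    refine lt_hammingNorm_of_pow_sum_eq_zero hα hx0 0 (2 * q) fun i hi => ?_
    rw [zero_add]
    rcases lt_trichotomy i q with hiq | rfl | hiq
    · exact ker₀ x hx i hiq
    -- Frobenius fixes the entries of `x` and sends the zero at `α` to one at `α^q`, filling the gap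
    -- between the two runs.
    · have h := congrArg (FiniteField.frobeniusAlgHom F K) (ker₀ x hx 1 (by omega))
      simpa only [map_sum, map_mul, AlgHom.commutes, FiniteField.coe_frobeniusAlgHom, hF, pow_one,
        map_zero] using h
    · have := ker₁ x hx' (i - (q + 1)) (by omega)
      rwa [show q + 1 + (i - (q + 1)) = i by omega] at this

theorem exists_basis_isPrimitiveRoot (F : Type*) [Field F] [Fintype F] {n : ℕ}
    (hn : n = Fintype.card F ^ 2 - 1) :
    ∃ (K : Type) (_ : Field K) (_ : Algebra F K) (_ : Module.Basis (Fin 2) F K) (α : K),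
      IsPrimitiveRoot α n := by
  obtain ⟨p, hp⟩ := CharP.exists F
  have : Fact p.Prime := ⟨CharP.char_is_prime F p⟩
  let K := FiniteField.Extension F p 2
  obtain ⟨g, hg⟩ := IsCyclic.exists_generator (α := Kˣ)
  refine ⟨K, inferInstance, inferInstance,
    Module.finBasisOfFinrankEq F K (FiniteField.finrank_extension F p 2), g, ?_⟩
  rw [IsPrimitiveRoot.coe_units_iff, hn, Fintype.card_eq_nat_card,
    ← FiniteField.natCard_extension F p 2, ← Nat.card_units,
    ← orderOf_eq_card_of_forall_mem_zpowers hg]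
  exact IsPrimitiveRoot.orderOf g

end Parameters

end ConvCode

theorem mainTheorem5 (q n : ℕ) (hq : IsPrimePow q) (hq4 : 4 ≤ q) (hn : n = q ^ 2 - 1)
    (F : Type*) [Field F] [Fintype F] (hF : Fintype.card F = q) :
    (∃ C : Submodule F[X] (Fin n → F[X]), ∃ d : ℕ, 2 * q + 1 ≤ d ∧
      ConvCode.HasParameters C (n - 2 * q + 1) (2 * q - 3) 1 d) ∧
    ∀ (K : Type*) [Field K] [Algebra F K] (B : Module.Basis (Fin 2) F K) (α : K),
      IsPrimitiveRoot α n →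
      ∀ (k₀ k₁ : ℕ) (H₀ : Matrix (Fin k₀) (Fin n) F) (H₁ : Matrix (Fin k₁) (Fin n) F),
        ConvCode.IsRowSelection (ConvCode.bchMatrix B α 0 q n) H₀ →
        ConvCode.IsRowSelection (ConvCode.bchMatrix B α (q + 1) (q - 1) n) H₁ →
        k₀ = 2 * q - 1 ∧ k₁ = 2 * q - 3 ∧
        ∃ d : ℕ, 2 * q + 1 ≤ d ∧
          ConvCode.HasParameters
            (ConvCode.dualCode (ConvCode.generatedCode (ConvCode.unitMemoryMatrix H₀ H₁)))
            (n - 2 * q + 1) (2 * q - 3) 1 d := by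
  have hn' : n = Fintype.card F ^ 2 - 1 := by rw [hF, hn]
  constructor
  · obtain ⟨K, _, _, B, α, hα⟩ := ConvCode.exists_basis_isPrimitiveRoot F hn'
    obtain ⟨k, H₀, h₀⟩ := ConvCode.exists_isRowSelection (ConvCode.bchMatrix B α 0 q n)
    obtain ⟨l, H₁, h₁⟩ := ConvCode.exists_isRowSelection (ConvCode.bchMatrix B α (q + 1) (q - 1) n)
    exact ⟨_, (ConvCode.rowSelection_hasParameters hF hq4 hn B hα h₀ h₁).2.2⟩
  · intro K _ _ B α hα k₀ k₁ H₀ H₁ h₀ h₁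
    exact ConvCode.rowSelection_hasParameters hF hq4 hn B hα h₀ h₁
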